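/- Let $m$ be normalized Lebesgue measure on the unit circle $\mathbb T$, and let $\alpha$ be a continuous rotationally symmetric norm on $L^\infty=L^\infty(\mathbb T,m)$. That is, $\alpha$ is a norm on the complex vector space $L^\infty$ with $\alpha(1)=1$, with $\alpha(|f|)=\alpha(f)$ and $\alpha(f_w)=\alpha(f)$ for all $f\in L^\infty$ and $w\in\mathbb T$, where $f_w(z)=f(\overline w z)$, and with $\alpha(\chi_E)\to 0$ as $m(E)\to 0^+$. Extend $\alpha$ to all measurable $f:\mathbb T\to\mathbb C$ by $$\alpha(f)=\sup\{\alpha(s) : s \text{ simple},\ 0\le s\le |f|\}\in[0,\infty],$$ and let $[S]_\alpha$ denote the $\alpha$-closure of a set $S$ of functions in $\{f : \alpha(f)<\infty\}$ (functions equal almost everywhere are identified). Let $H^\infty=\{f\in L^\infty : \int_{\mathbb T} f z^{-k}\,dm=0 \text{ for all integers } k<0\}$ and $H^\alpha=[H^\infty]_\alpha$. For an integer $n\ge 1$ let $H^\infty(z^n)=\{g(z^n) : g\in H^\infty\}$ and $M_\alpha(z^n)=[H^\infty(z^n)]_\alpha$. A function $f\in H^\alpha$ is called *$n$-outer* if there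 is a nonzero polynomial $p$ of degree less than $n$ with $$[f\cdot H^\infty(z^n)]_\alpha = p\cdot M_\alpha(z^n),$$ and it is called *outer* in $H^\alpha$ if $[f\cdot H^\infty]_\alpha=H^\alpha$. **Theorem.** Let $n\ge 1$. Every $n$-outer function $f\in H^\alpha$ that belongs to $M_\alpha(z^n)$ is outer in $H^\alpha$. -/

import Mathlib

open MeasureTheory Polynomial
open scoped ENNReal NNReal

noncomputable section

namespace GaugeHardy

/-- The unit circle, parametrised by `x ↦ z = exp (2 π i x)`, `x ∈ ℝ / ℤ`. In this parametrisation
rotation is translation and `z ↦ z ^ n` is `x ↦ n • x`. -/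
abbrev Torus : Type := UnitAddCircle

/-- Normalized Lebesgue measure on the circle. -/
abbrev m : Measure Torus := AddCircle.haarAddCircle

/-- Measurable functions `𝕋 → ℂ` modulo equality almost everywhere. -/
abbrev L0 : Type := Torus →ₘ[m] ℂ

/-- The space `L^∞` of the circle. -/
abbrev Linf : Type := Lp ℂ ∞ m

/-- The modulus `|f|` of `f ∈ L^∞`, as an element of `L^∞`. -/
def absLinf (f : Linf) : Linf :=
  MemLp.toLp (fun x => ((‖f x‖ : ℝ) : ℂ)) (Lp.memLp f).norm.ofReal

/-- The rotate of `f ∈ L^∞` by `w = exp (2 π i a)`, namely `z ↦ f (w⁻¹ z)`. -/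
def rotate (a : Torus) (f : Linf) : Linf :=
  Lp.compMeasurePreserving (fun x => x - a) (measurePreserving_sub_right m a) f

/-- The characteristic function of a measurable set, as an element of `L^∞`. -/
def charFn (E : Set Torus) (hE : MeasurableSet E) : Linf :=
  indicatorConstLp ∞ hE (measure_ne_top m E) (1 : ℂ)

/-- `α` is a rotationally symmetric norm on `L^∞`. Subadditivity and absolute homogeneity over `ℂ`
are part of `Seminorm`. -/
structure IsRotSymmNorm (α : Seminorm ℂ Linf) : Prop where
  eq_zero_of_map_eq_zero : ∀ f : Linf, α f = 0 → f = 0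
  map_one : α (Lp.const ∞ m (1 : ℂ)) = 1
  map_abs : ∀ f : Linf, α (absLinf f) = α f
  map_rotate : ∀ (a : Torus) (f : Linf), α (rotate a f) = α f

/-- The norm `α` is continuous: `α (χ_E) → 0` as `m E → 0`. -/
def IsContinuousNorm (α : Seminorm ℂ Linf) : Prop :=
  ∀ ε : ℝ, 0 < ε → ∃ δ : ℝ, 0 < δ ∧
    ∀ (E : Set Torus) (hE : MeasurableSet E), m.real E < δ → α (charFn E hE) < ε

/-- A nonnegative simple function, as an element of `L^∞`. -/
def simpleToLinf (s : SimpleFunc Torus ℝ≥0) : Linf :=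
  MemLp.toLp (s.map (fun t : ℝ≥0 => ((t : ℝ) : ℂ))) ((s.map _).memLp_top m)

/-- The extension of `α` to all measurable functions:
`α(f) = sup {α(s) : s simple, 0 ≤ s ≤ |f|}`, with values in `[0, ∞]`. -/
def extNorm (α : Seminorm ℂ Linf) (f : L0) : ℝ≥0∞ :=
  ⨆ (s : SimpleFunc Torus ℝ≥0) (_ : ∀ᵐ x ∂m, s x ≤ ‖f x‖₊), ENNReal.ofReal (α (simpleToLinf s))

/-- The space of all measurable `f` with `α(f) < ∞`. -/
def scriptL (α : Seminorm ℂ Linf) : Set L0 := {f | extNorm α f < ∞}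

/-- The `α`-closure `[S]_α` of a set `S` of measurable functions, taken in `scriptL α`. -/
def alphaClosure (α : Seminorm ℂ Linf) (S : Set L0) : Set L0 :=
  {f | f ∈ scriptL α ∧ ∀ ε : ℝ≥0∞, 0 < ε → ∃ g ∈ S, extNorm α (f - g) < ε}

/-- `H^∞`: the functions in `L^∞` whose Fourier coefficients of negative index vanish. -/
def Hinf : Set L0 :=
  {f | f ∈ Lp ℂ ∞ m ∧ ∀ k : ℤ, k < 0 → fourierCoeff (T := (1 : ℝ)) f k = 0}

/-- `H^∞(z^n)`: the functions `z ↦ g (z ^ n)` with `g ∈ H^∞`. -/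
def HinfPow (n : ℕ) : Set L0 :=
  {f | ∃ g ∈ Hinf, ∀ᵐ x ∂m, f x = g (n • x)}

/-- The general Hardy space `H^α`, the `α`-closure of `H^∞`. -/
def Halpha (α : Seminorm ℂ Linf) : Set L0 := alphaClosure α Hinf

/-- `M_α(z^n)`, the `α`-closure of `H^∞(z^n)`. -/
def Malpha (α : Seminorm ℂ Linf) (n : ℕ) : Set L0 := alphaClosure α (HinfPow n)

/-- The set `f · S` of all products `f g`, `g ∈ S`. -/
def mulSet (f : L0) (S : Set L0) : Set L0 := (fun g => f * g) '' S

/-- The polynomial function `z ↦ p(z)` on the circle; `fourier 1 x = exp (2 π i x) = z`. -/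
def polyFn (p : ℂ[X]) : L0 :=
  ContinuousMap.toAEEqFun m
    (⟨fun x => p.eval (fourier 1 x), p.continuous.comp (fourier 1).continuous⟩ : C(Torus, ℂ))

/-- `f` is outer in `H^α`: `f ∈ H^α` and `[f · H^∞]_α = H^α`. -/
def IsOuter (α : Seminorm ℂ Linf) (f : L0) : Prop :=
  f ∈ Halpha α ∧ alphaClosure α (mulSet f Hinf) = Halpha α

/-- `f` is `n`-outer in `H^α`: `f ∈ H^α` and `[f · H^∞(z^n)]_α = p · M_α(z^n)` for some nonzero
polynomial `p` of degree less than `n`. -/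
def IsNOuter (α : Seminorm ℂ Linf) (n : ℕ) (f : L0) : Prop :=
  f ∈ Halpha α ∧ ∃ p : ℂ[X], p ≠ 0 ∧ p.natDegree < n ∧
    alphaClosure α (mulSet f (HinfPow n)) = mulSet (polyFn p) (Malpha α n)

end GaugeHardy

end

namespace GaugeHardy

/-! ### Monotonicity of the norm -/

/-! Write `M` for `M_α(z^n)`. Since `H^∞(z^n)` is an algebra and multiplication by a bounded
function is `α`-continuous, `f ∈ M` forces `[f · H^∞(z^n)]_α ⊆ M`. As `1 ∈ M`, the polynomial `p`
lies in `M`. Rotation by a primitive `n`-th root of unity is an `α`-isometry fixing `H^∞(z^n)`, so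
it fixes every bounded element of `M` (`rotate_eq_self_of_mem_Malpha`); as `deg p < n`, only the
constant term of `p` survives (`eq_C_of_polyFn_mem_Malpha`). Thus a nonzero constant lies in `[f ·
H^∞]_α`, and multiplying by `H^∞` and closing up gives all of `H^α`. The opposite inclusion comes
from `f ∈ H^α`.

The groundwork is that the extended norm is subadditive and agrees with `α` on `L^∞`, and that `H^∞`
is an algebra containing `H^∞(z^n)`. -/

theorem norm_le_norm_of_mem (f : Linf) : ∀ᵐ x ∂m, ‖f x‖ ≤ ‖f‖ := by
  have h := ae_le_eLpNormEssSup (f := f) (μ := m)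
  filter_upwards [h] with x hx
  rw [Lp.norm_def, eLpNorm_exponent_top]
  have h2 : eLpNormEssSup f m ≠ ∞ := by
    have := Lp.eLpNorm_ne_top f
    rwa [eLpNorm_exponent_top] at this
  calc ‖f x‖ = (‖f x‖ₑ).toReal := by simp
    _ ≤ _ := ENNReal.toReal_mono h2 hx

theorem coeFn_absLinf (f : Linf) : ∀ᵐ x ∂m, absLinf f x = ((‖f x‖ : ℝ) : ℂ) :=
  MemLp.coeFn_toLp _

theorem norm_eq_of_ae_norm_eq {α : Seminorm ℂ Linf} (hα : IsRotSymmNorm α) {f g : Linf}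
    (h : ∀ᵐ x ∂m, ‖f x‖ = ‖g x‖) : α f = α g := by
  rw [← hα.map_abs f, ← hα.map_abs g]
  congr 1
  apply Lp.ext
  filter_upwards [coeFn_absLinf f, coeFn_absLinf g, h] with x h1 h2 h3
  rw [h1, h2, h3]

/-- `|f|` is the average of `|f| ± i √(|g|² - |f|²)`, two functions of modulus `|g|`. -/
theorem norm_mono {α : Seminorm ℂ Linf} (hα : IsRotSymmNorm α) {f g : Linf}
    (h : ∀ᵐ x ∂m, ‖f x‖ ≤ ‖g x‖) : α f ≤ α g := by
  let r : Torus → ℝ := fun x => √(‖g x‖ ^ 2 - ‖f x‖ ^ 2)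
  have hfm := (Lp.aestronglyMeasurable f).norm
  have hgm := (Lp.aestronglyMeasurable g).norm
  have hr : AEStronglyMeasurable r m :=
    Real.continuous_sqrt.comp_aestronglyMeasurable ((hgm.pow 2).sub (hfm.pow 2))
  have key : ∀ c : ℝ, c ^ 2 = 1 → ∃ a : Linf, α a = α g ∧
      ∀ᵐ x ∂m, a x = (‖f x‖ : ℂ) + (c * r x : ℝ) * Complex.I := by
    intro c hc
    have hmeas : AEStronglyMeasurable
        (fun x => ((‖f x‖ : ℝ) : ℂ) + ((c * r x : ℝ) : ℂ) * Complex.I) m :=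
      (Complex.continuous_ofReal.comp_aestronglyMeasurable hfm).add
        ((Complex.continuous_ofReal.comp_aestronglyMeasurable (hr.const_mul c)).mul_const _)
    have hnorm : ∀ᵐ x ∂m, ‖((‖f x‖ : ℝ) : ℂ) + ((c * r x : ℝ) : ℂ) * Complex.I‖ = ‖g x‖ := by
      filter_upwards [h] with x hx
      rw [Complex.norm_add_mul_I, mul_pow, hc, one_mul, Real.sq_sqrt, add_sub_cancel,
        Real.sqrt_sq (norm_nonneg _)]
      have := norm_nonneg (f x)
      nlinarith
    have hmem : MemLp (fun x => ((‖f x‖ : ℝ) : ℂ) + ((c * r x : ℝ) : ℂ) * Complex.I) ∞ m :=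
      (memLp_congr_norm hmeas (Lp.aestronglyMeasurable g) hnorm).2 (Lp.memLp g)
    refine ⟨hmem.toLp _, norm_eq_of_ae_norm_eq hα ?_, MemLp.coeFn_toLp _⟩
    filter_upwards [hmem.coeFn_toLp, hnorm] with x h1 h2
    rw [h1, h2]
  obtain ⟨a, ha, ha'⟩ := key 1 (by norm_num)
  obtain ⟨b, hb, hb'⟩ := key (-1) (by norm_num)
  have hab : absLinf f = (1 / 2 : ℂ) • (a + b) := by
    apply Lp.ext
    filter_upwards [coeFn_absLinf f, ha', hb', Lp.coeFn_smul (1 / 2 : ℂ) (a + b),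
      Lp.coeFn_add a b] with x h1 h2 h3 h4 h5
    rw [h1, h4, Pi.smul_apply, h5, Pi.add_apply, h2, h3]
    push_cast
    simp only [smul_eq_mul]
    ring
  calc α f = α (absLinf f) := (hα.map_abs f).symm
    _ ≤ 1 / 2 * (α a + α b) := by
      rw [hab, map_smul_eq_mul]
      have := map_add_le_add α a b
      norm_num
      linarith
    _ = α g := by rw [ha, hb]; ring

/-! ### The extended norm -/

theorem coeFn_simpleToLinf (s : SimpleFunc Torus ℝ≥0) :
    ∀ᵐ x ∂m, simpleToLinf s x = ((s x : ℝ) : ℂ) :=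
  MemLp.coeFn_toLp _

theorem norm_simpleToLinf (s : SimpleFunc Torus ℝ≥0) :
    ∀ᵐ x ∂m, ‖simpleToLinf s x‖ = s x := by
  filter_upwards [coeFn_simpleToLinf s] with x hx
  rw [hx]; simp

/-- A bounded measurable function is uniformly approximated from below by simple functions. -/
theorem exists_simpleFunc_le_add {u : Torus → ℝ≥0} (hu : Measurable u) {C : ℝ≥0}
    (hC : ∀ x, u x ≤ C) {ε : ℝ≥0} (hε : 0 < ε) :
    ∃ s : SimpleFunc Torus ℝ≥0, ∀ x, s x ≤ u x ∧ u x ≤ s x + ε := by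
  -- Round `u` down to a multiple of `ε`; the bound `C` leaves finitely many values.
  have hmeas : Measurable fun x => (⌊u x / ε⌋₊ : ℝ≥0) * ε :=
    ((measurable_from_nat (f := fun n : ℕ => (n : ℝ≥0))).comp
      (Nat.measurable_floor.comp (hu.div_const ε))).mul_const ε
  refine ⟨⟨fun x => (⌊u x / ε⌋₊ : ℝ≥0) * ε, fun y => hmeas (measurableSet_singleton y), ?_⟩, ?_⟩
  · apply ((Set.finite_Iic ⌊C / ε⌋₊).image fun n : ℕ => (n : ℝ≥0) * ε).subset
    rintro _ ⟨x, rfl⟩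
    exact ⟨⌊u x / ε⌋₊, Nat.floor_mono (by gcongr; exact hC x), rfl⟩
  · intro x
    have h1 : (⌊u x / ε⌋₊ : ℝ≥0) ≤ u x / ε := Nat.floor_le (zero_le)
    have h2 : u x / ε ≤ ⌊u x / ε⌋₊ + 1 := (Nat.lt_floor_add_one _).le
    constructor
    · exact (le_div_iff₀ hε).1 h1
    · have := (div_le_iff₀ hε).1 h2
      simpa [add_mul] using this

theorem ofReal_norm_le_extNorm {α : Seminorm ℂ Linf} (hα : IsRotSymmNorm α) {F : Linf} {f : L0}
    (h : ∀ᵐ x ∂m, ‖F x‖ ≤ ‖f x‖) : ENNReal.ofReal (α F) ≤ extNorm α f := by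
  apply ENNReal.le_of_forall_pos_le_add
  intro ε hε _
  -- `|F|` is bounded only almost everywhere, so it is truncated at `‖F‖`. The uniform error `ε`
  -- costs `ε` in `α` because `α(1) = 1`.
  obtain ⟨s, hs⟩ := exists_simpleFunc_le_add (u := fun x => min ‖F x‖₊ ‖F‖₊) (C := ‖F‖₊)
    ((Lp.stronglyMeasurable F).measurable.nnnorm.min measurable_const)
    (fun x => min_le_right _ _) hε
  have hsf : ∀ᵐ x ∂m, s x ≤ ‖f x‖₊ := by
    filter_upwards [h] with x hx
    exact ((hs x).1.trans (min_le_left _ _)).trans hx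
  have hle : α F ≤ α (simpleToLinf s) + ε := by
    calc α F ≤ α (simpleToLinf s + (ε : ℂ) • Lp.const ∞ m (1 : ℂ)) := by
          apply norm_mono hα
          filter_upwards [norm_le_norm_of_mem F, coeFn_simpleToLinf s,
            Lp.coeFn_add (simpleToLinf s) ((ε : ℂ) • Lp.const ∞ m (1 : ℂ)),
            Lp.coeFn_smul (ε : ℂ) (Lp.const ∞ m (1 : ℂ)),
            Lp.coeFn_const ∞ m (1 : ℂ)] with x h1 h2 h3 h4 h5
          rw [h3, Pi.add_apply, h4, Pi.smul_apply, h5, h2]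
          have h6 := (hs x).2
          rw [min_eq_left (show ‖F x‖₊ ≤ ‖F‖₊ from h1)] at h6
          have h7 : ‖F x‖ ≤ s x + ε := by exact_mod_cast h6
          refine h7.trans (le_of_eq ?_)
          have : ((s x : ℝ) : ℂ) + (ε : ℂ) • Function.const Torus (1 : ℂ) x
              = (((s x + ε : ℝ≥0) : ℝ) : ℂ) := by
            simp
          rw [this, Complex.norm_real, NNReal.norm_eq, NNReal.coe_add]
      _ ≤ α (simpleToLinf s) + ε := by
          refine (map_add_le_add α _ _).trans ?_
          rw [map_smul_eq_mul, hα.map_one]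
          simp
  calc ENNReal.ofReal (α F) ≤ ENNReal.ofReal (α (simpleToLinf s) + ε) :=
        ENNReal.ofReal_le_ofReal hle
    _ = ENNReal.ofReal (α (simpleToLinf s)) + ε := by
        rw [ENNReal.ofReal_add (apply_nonneg α _) ε.coe_nonneg, ENNReal.ofReal_coe_nnreal]
    _ ≤ extNorm α f + ε := by
        gcongr
        exact le_iSup₂_of_le s hsf le_rfl

theorem extNorm_coe {α : Seminorm ℂ Linf} (hα : IsRotSymmNorm α) (F : Linf) :
    extNorm α (F : L0) = ENNReal.ofReal (α F) := by
  apply le_antisymm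
  · apply iSup₂_le
    intro s hs
    apply ENNReal.ofReal_le_ofReal
    apply norm_mono hα
    filter_upwards [hs, norm_simpleToLinf s] with x h1 h2
    rw [h2]
    exact h1
  · exact ofReal_norm_le_extNorm hα (ae_of_all _ fun _ => le_rfl)

/-- A simple `s ≤ |f + g|` is split in the ratio `|f| : |g|`. The pieces are bounded but need not be
simple, hence `ofReal_norm_le_extNorm`. -/
theorem extNorm_add_le {α : Seminorm ℂ Linf} (hα : IsRotSymmNorm α) (f g : L0) :
    extNorm α (f + g) ≤ extNorm α f + extNorm α g := by
  apply iSup₂_le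
  intro s hs
  have key : ∀ u v : L0, ∃ a : Linf, ∀ᵐ x ∂m,
      a x = ((s x * (‖u x‖ / (‖u x‖ + ‖v x‖)) : ℝ) : ℂ) := by
    intro u v
    have hu := u.aestronglyMeasurable.norm.aemeasurable
    have hv := v.aestronglyMeasurable.norm.aemeasurable
    have hmeas : AEMeasurable (fun x => (s x * (‖u x‖ / (‖u x‖ + ‖v x‖)) : ℝ)) m :=
      s.measurable.coe_nnreal_real.aemeasurable.mul (hu.div (hu.add hv))
    have hmem : MemLp (fun x => ((s x * (‖u x‖ / (‖u x‖ + ‖v x‖)) : ℝ) : ℂ)) ∞ m := by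
      refine MemLp.of_le (Lp.memLp (simpleToLinf s))
        (Complex.measurable_ofReal.comp_aemeasurable hmeas).aestronglyMeasurable ?_
      filter_upwards [norm_simpleToLinf s] with x hx
      rw [hx, Complex.norm_real, Real.norm_of_nonneg (by positivity)]
      apply mul_le_of_le_one_right (by positivity)
      apply div_le_one_of_le₀ _ (by positivity)
      linarith [norm_nonneg (v x)]
    exact ⟨hmem.toLp _, hmem.coeFn_toLp⟩
  have bound : ∀ u v : L0, (∀ᵐ x ∂m, (s x : ℝ) ≤ ‖u x‖ + ‖v x‖) → ∀ a : Linf,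
      (∀ᵐ x ∂m, a x = ((s x * (‖u x‖ / (‖u x‖ + ‖v x‖)) : ℝ) : ℂ)) →
      ∀ᵐ x ∂m, ‖a x‖ ≤ ‖u x‖ := by
    intro u v huv a ha
    filter_upwards [huv, ha] with x h1 h2
    rw [h2, Complex.norm_real, Real.norm_of_nonneg (by positivity), ← mul_div_assoc]
    apply div_le_of_le_mul₀ (by positivity) (by positivity)
    rw [mul_comm]
    gcongr
  have hsum : ∀ᵐ x ∂m, (s x : ℝ) ≤ ‖f x‖ + ‖g x‖ := by
    filter_upwards [hs, AEEqFun.coeFn_add f g] with x h1 h2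
    rw [h2] at h1
    exact (show (s x : ℝ) ≤ ‖f x + g x‖ from h1).trans (norm_add_le _ _)
  obtain ⟨a, ha⟩ := key f g
  obtain ⟨b, hb⟩ := key g f
  have hab : simpleToLinf s = a + b := by
    apply Lp.ext
    filter_upwards [coeFn_simpleToLinf s, Lp.coeFn_add a b, ha, hb, hsum] with x h1 h2 h3 h4 h5
    rw [h1, h2, Pi.add_apply, h3, h4, ← Complex.ofReal_add, add_comm ‖g x‖, ← mul_add, ← add_div]
    congr 1
    -- Where both vanish the quotient is `0 / 0 = 0`, harmless because `s` vanishes there too.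
    by_cases h0 : ‖f x‖ + ‖g x‖ = 0
    · rw [h0] at h5 ⊢
      simpa using h5.antisymm (s x).coe_nonneg
    · rw [div_self h0, mul_one]
  calc ENNReal.ofReal (α (simpleToLinf s)) ≤ ENNReal.ofReal (α a + α b) := by
        rw [hab]
        exact ENNReal.ofReal_le_ofReal (map_add_le_add α a b)
    _ = ENNReal.ofReal (α a) + ENNReal.ofReal (α b) :=
        ENNReal.ofReal_add (apply_nonneg α _) (apply_nonneg α _)
    _ ≤ _ := add_le_add (ofReal_norm_le_extNorm hα (bound f g hsum a ha))
        (ofReal_norm_le_extNorm hα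
          (bound g f (by filter_upwards [hsum] with x hx; rwa [add_comm]) b hb))

theorem extNorm_sub_le {α : Seminorm ℂ Linf} (hα : IsRotSymmNorm α) (f g h : L0) :
    extNorm α (f - h) ≤ extNorm α (f - g) + extNorm α (g - h) := by
  rw [← sub_add_sub_cancel f g h]
  exact extNorm_add_le hα _ _

theorem extNorm_mul_le (α : Seminorm ℂ Linf) (f : L0) (F : Linf) :
    extNorm α (f * (F : L0)) ≤ ENNReal.ofReal (‖F‖ + 1) * extNorm α f := by
  -- The `+ 1` makes the constant invertible even for `F = 0`.
  have hC : (0 : ℝ) < ‖F‖ + 1 := by positivity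
  let C : ℝ≥0 := ⟨‖F‖ + 1, hC.le⟩
  have hC0 : C ≠ 0 := fun h => hC.ne' (congrArg NNReal.toReal h)
  apply iSup₂_le
  intro s hs
  let t : SimpleFunc Torus ℝ≥0 := s.map fun y => C⁻¹ * y
  have hst : simpleToLinf s = ((C : ℝ) : ℂ) • simpleToLinf t := by
    apply Lp.ext
    filter_upwards [coeFn_simpleToLinf s, coeFn_simpleToLinf t,
      Lp.coeFn_smul ((C : ℝ) : ℂ) (simpleToLinf t)] with x h1 h2 h3
    rw [h3, Pi.smul_apply, h2, h1, smul_eq_mul, ← Complex.ofReal_mul, ← NNReal.coe_mul]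
    simp [t, mul_inv_cancel_left₀ hC0]
  have ht : ∀ᵐ x ∂m, t x ≤ ‖f x‖₊ := by
    filter_upwards [hs, AEEqFun.coeFn_mul f (F : L0), norm_le_norm_of_mem F] with x h1 h2 h3
    rw [h2, Pi.mul_apply, nnnorm_mul] at h1
    have h4 : ‖F x‖₊ ≤ C := by
      change ‖F x‖ ≤ ‖F‖ + 1
      linarith
    change C⁻¹ * s x ≤ _
    rw [inv_mul_le_iff₀ (pos_iff_ne_zero.2 hC0), mul_comm]
    exact h1.trans (by gcongr)
  have hle : ENNReal.ofReal (α (simpleToLinf t)) ≤ extNorm α f := le_iSup₂_of_le t ht le_rfl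
  rw [hst, map_smul_eq_mul, Complex.norm_real, NNReal.norm_eq, ENNReal.ofReal_mul C.coe_nonneg]
  exact mul_le_mul' le_rfl hle

/-! ### The closure operation -/

theorem alphaClosure_mono (α : Seminorm ℂ Linf) {S S' : Set L0} (h : S ⊆ S') :
    alphaClosure α S ⊆ alphaClosure α S' := by
  rintro f ⟨hf, hf'⟩
  refine ⟨hf, fun ε hε => ?_⟩
  obtain ⟨g, hg, hlt⟩ := hf' ε hε
  exact ⟨g, h hg, hlt⟩

theorem alphaClosure_subset_alphaClosure {α : Seminorm ℂ Linf} (hα : IsRotSymmNorm α)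
    {S S' : Set L0} (h : S ⊆ alphaClosure α S') : alphaClosure α S ⊆ alphaClosure α S' := by
  rintro f ⟨hf, hf'⟩
  refine ⟨hf, fun ε hε => ?_⟩
  obtain ⟨g, hg, hlt⟩ := hf' (ε / 2) (ENNReal.half_pos hε.ne')
  obtain ⟨k, hk, hlt'⟩ := (h hg).2 (ε / 2) (ENNReal.half_pos hε.ne')
  refine ⟨k, hk, (extNorm_sub_le hα f g k).trans_lt ?_⟩
  calc _ < ε / 2 + ε / 2 := ENNReal.add_lt_add hlt hlt'
    _ = ε := ENNReal.add_halves ε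

theorem Linf_subset_scriptL {α : Seminorm ℂ Linf} (hα : IsRotSymmNorm α) (F : Linf) :
    (F : L0) ∈ scriptL α := by
  change extNorm α _ < ∞
  rw [extNorm_coe hα]
  exact ENNReal.ofReal_lt_top

theorem mem_alphaClosure_of_mem {α : Seminorm ℂ Linf} (hα : IsRotSymmNorm α) {S : Set L0}
    {f : L0} (hf : f ∈ S) (hf' : f ∈ scriptL α) : f ∈ alphaClosure α S := by
  refine ⟨hf', fun ε hε => ⟨f, hf, ?_⟩⟩
  have h0 : extNorm α (((0 : Linf) : L0)) = 0 := by
    rw [extNorm_coe hα, map_zero, ENNReal.ofReal_zero]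
  rw [sub_self]
  exact h0.trans_lt hε

theorem mul_mem_alphaClosure {α : Seminorm ℂ Linf} {S S' : Set L0} {h f : L0}
    (hh : h ∈ Lp ℂ ∞ m) (hmul : ∀ g ∈ S, g * h ∈ S') (hf : f ∈ alphaClosure α S) :
    f * h ∈ alphaClosure α S' := by
  let F : Linf := ⟨h, hh⟩
  have hC0 : ENNReal.ofReal (‖F‖ + 1) ≠ 0 := by
    rw [Ne, ENNReal.ofReal_eq_zero, not_le]
    positivity
  refine ⟨(extNorm_mul_le α f F).trans_lt (ENNReal.mul_lt_top ENNReal.ofReal_lt_top hf.1),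
    fun ε hε => ?_⟩
  obtain ⟨g, hg, hlt⟩ := hf.2 (ε / ENNReal.ofReal (‖F‖ + 1))
    (ENNReal.div_pos hε.ne' ENNReal.ofReal_ne_top)
  refine ⟨g * h, hmul g hg, ?_⟩
  have hfg : f * h - g * h = (f - g) * h := by
    apply AEEqFun.ext
    filter_upwards [AEEqFun.coeFn_sub (f * h) (g * h), AEEqFun.coeFn_mul f h,
      AEEqFun.coeFn_mul g h, AEEqFun.coeFn_mul (f - g) h, AEEqFun.coeFn_sub f g]
      with x h1 h2 h3 h4 h5
    rw [h1, h4, Pi.sub_apply, Pi.mul_apply, h2, h3, h5, Pi.sub_apply, Pi.mul_apply, Pi.mul_apply,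
      sub_mul]
  rw [hfg]
  refine (extNorm_mul_le α (f - g) F).trans_lt ?_
  rw [mul_comm]
  exact (ENNReal.lt_div_iff_mul_lt (Or.inl hC0) (Or.inl ENNReal.ofReal_ne_top)).1 hlt

/-! ### The algebras `H^∞` and `H^∞(z^n)` -/

theorem mul_mem_Linf {f g : L0} (hf : f ∈ Lp ℂ ∞ m) (hg : g ∈ Lp ℂ ∞ m) :
    f * g ∈ Lp ℂ ∞ m := by
  rw [Lp.mem_Lp_iff_memLp] at *
  exact (hg.mul (r := ∞) hf).ae_eq (AEEqFun.coeFn_mul f g).symm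

theorem measurable_fourier (k : ℤ) : Measurable fun x : Torus => (fourier k x : ℂ) :=
  (fourier k).continuous.measurable

/-- Parseval for the `L²` functions `conj f` and `z^(-k) g` gives the `k`-th coefficient of `f g` as
the sum of `f̂(-i) ĝ(i + k)`. For `k < 0` one of the two indices is always negative. -/
theorem mul_mem_Hinf {f g : L0} (hf : f ∈ Hinf) (hg : g ∈ Hinf) : f * g ∈ Hinf := by
  refine ⟨mul_mem_Linf hf.1 hg.1, fun k hk => ?_⟩
  have hf2 : MemLp (fun x => starRingEnd ℂ (f x)) 2 m :=
    ((Lp.mem_Lp_iff_memLp.1 hf.1).mono_exponent le_top).star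
  have hg2 : MemLp (fun x => fourier (-k) x * g x) 2 m := by
    refine MemLp.of_le ((Lp.mem_Lp_iff_memLp.1 hg.1).mono_exponent le_top)
      ((measurable_fourier _).aestronglyMeasurable.mul g.aestronglyMeasurable)
      (ae_of_all _ fun x => ?_)
    rw [norm_mul, fourier_apply, Circle.norm_coe, one_mul]
  have hsum := (fourierBasis (T := (1 : ℝ))).hasSum_inner_mul_inner (hf2.toLp _) (hg2.toLp _)
  have h1 : ∀ i : ℤ, inner ℂ (hf2.toLp _) (fourierBasis (T := (1 : ℝ)) i)
      = fourierCoeff (T := (1 : ℝ)) f (-i) := by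
    intro i
    rw [L2.inner_def, coe_fourierBasis, fourierCoeff]
    apply integral_congr_ae
    filter_upwards [hf2.coeFn_toLp, coeFn_fourierLp (T := (1 : ℝ)) 2 i] with x h2 h3
    rw [h2, h3, neg_neg]
    simp
  have h2 : ∀ i : ℤ, inner ℂ (fourierBasis (T := (1 : ℝ)) i) (hg2.toLp _)
      = fourierCoeff (T := (1 : ℝ)) g (i + k) := by
    intro i
    rw [L2.inner_def, coe_fourierBasis, fourierCoeff]
    apply integral_congr_ae
    filter_upwards [hg2.coeFn_toLp, coeFn_fourierLp (T := (1 : ℝ)) 2 i] with x h2 h3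
    rw [h2, h3, neg_add, fourier_add, fourier_neg (n := i), RCLike.inner_apply, smul_eq_mul]
    ring
  have h3 : inner ℂ (hf2.toLp _) (hg2.toLp _) = fourierCoeff (T := (1 : ℝ)) (f * g : L0) k := by
    rw [L2.inner_def, fourierCoeff]
    apply integral_congr_ae
    filter_upwards [hf2.coeFn_toLp, hg2.coeFn_toLp, AEEqFun.coeFn_mul f g] with x h2 h3 h4
    rw [h2, h3, h4, RCLike.inner_apply, smul_eq_mul, Pi.mul_apply, Complex.conj_conj]
    ring
  rw [← h3, ← hsum.tsum_eq]
  refine (tsum_congr fun i => ?_).trans tsum_zero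
  rw [h1, h2]
  rcases le_or_gt i 0 with hi | hi
  · rw [hg.2 _ (by lia), mul_zero]
  · rw [hf.2 _ (by lia), zero_mul]

theorem const_mem_Linf (c : ℂ) : AEEqFun.const Torus c ∈ Lp ℂ ∞ m := (Lp.const ∞ m c).2

theorem const_mem_Hinf (c : ℂ) : (AEEqFun.const Torus c : L0) ∈ Hinf := by
  refine ⟨const_mem_Linf c, fun k hk => ?_⟩
  have h : fourierCoeff (T := (1 : ℝ)) (AEEqFun.const Torus c : L0) k
      = c * fourierCoeff (T := (1 : ℝ)) (fourier (T := (1 : ℝ)) 0) k := by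
    rw [← fourierCoeff.const_mul]
    refine congrFun (fourierCoeff_congr_ae ?_) k
    filter_upwards [AEEqFun.coeFn_const (μ := m) Torus c] with x hx
    rw [hx, fourier_zero, mul_one]
    rfl
  have h2 : fourierCoeff (T := (1 : ℝ)) (fourier (T := (1 : ℝ)) 0) k = 0 := by
    have h3 := orthonormal_iff_ite.1 (orthonormal_fourier (T := (1 : ℝ))) k 0
    rw [if_neg hk.ne, L2.inner_def] at h3
    rw [← h3, fourierCoeff]
    apply integral_congr_ae
    filter_upwards [coeFn_fourierLp (T := (1 : ℝ)) 2 k, coeFn_fourierLp (T := (1 : ℝ)) 2 0]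
      with x h4 h5
    rw [h4, h5, RCLike.inner_apply, fourier_neg, smul_eq_mul, mul_comm]
  rw [h, h2, mul_zero]

theorem measurePreserving_nsmul {n : ℕ} (hn : 1 ≤ n) :
    MeasurePreserving (fun x : Torus => n • x) m m := by
  have h := Measure.measurePreserving_zsmul m (n := (n : ℤ)) (by lia)
  simpa using h

theorem const_mem_HinfPow {n : ℕ} (hn : 1 ≤ n) (c : ℂ) :
    (AEEqFun.const Torus c : L0) ∈ HinfPow n := by
  refine ⟨_, const_mem_Hinf c, ?_⟩
  have h := AEEqFun.coeFn_const (μ := m) Torus c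
  filter_upwards [h, (measurePreserving_nsmul hn).quasiMeasurePreserving.ae h] with x h1 h2
  rw [h1, h2]
  rfl

theorem mul_mem_HinfPow {n : ℕ} (hn : 1 ≤ n) {f g : L0} (hf : f ∈ HinfPow n)
    (hg : g ∈ HinfPow n) : f * g ∈ HinfPow n := by
  obtain ⟨u, hu, hfu⟩ := hf
  obtain ⟨v, hv, hgv⟩ := hg
  refine ⟨u * v, mul_mem_Hinf hu hv, ?_⟩
  filter_upwards [AEEqFun.coeFn_mul f g, hfu, hgv,
    (measurePreserving_nsmul hn).quasiMeasurePreserving.ae (AEEqFun.coeFn_mul u v)]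
    with x h1 h2 h3 h4
  rw [h1, h4, Pi.mul_apply, Pi.mul_apply, h2, h3]

theorem nsmul_inv_coe {n : ℕ} (hn : 1 ≤ n) : n • (((1 / n : ℝ)) : Torus) = 0 := by
  have hn' : (n : ℝ) ≠ 0 := by positivity
  rw [← AddCircle.coe_nsmul, nsmul_eq_mul, mul_one_div_cancel hn']
  exact AddCircle.coe_period 1

theorem fourier_inv_eq_one_iff {n : ℕ} (hn : 1 ≤ n) (k : ℤ) :
    (fourier k (((1 / n : ℝ)) : Torus) : ℂ) = 1 ↔ (n : ℤ) ∣ k := by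
  have hord : addOrderOf (((1 / n : ℝ)) : Torus) = n := by
    exact AddCircle.addOrderOf_period_div (p := (1 : ℝ)) hn
  rw [fourier_apply, Circle.coe_eq_one, ← AddCircle.toCircle_zero (T := (1 : ℝ)),
    (AddCircle.injective_toCircle one_ne_zero).eq_iff, ← addOrderOf_dvd_iff_zsmul_eq_zero, hord]

/-- If `k = n j`, the measure-preserving map `x ↦ n • x` identifies the `k`-th coefficient with the
`j`-th one of `g`. Otherwise translation by `1 / n` multiplies the integral by a root of unity other
than `1`, so it vanishes. -/
theorem HinfPow_subset_Hinf {n : ℕ} (hn : 1 ≤ n) : HinfPow n ⊆ Hinf := by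
  rintro f ⟨g, hg, hfg⟩
  have hmp := measurePreserving_nsmul hn
  refine ⟨?_, fun k hk => ?_⟩
  · rw [Lp.mem_Lp_iff_memLp]
    exact ((Lp.mem_Lp_iff_memLp.1 hg.1).comp_measurePreserving hmp).ae_eq (Filter.EventuallyEq.symm hfg)
  rw [congrFun (fourierCoeff_congr_ae hfg) k]
  by_cases hdvd : (n : ℤ) ∣ k
  · obtain ⟨j, rfl⟩ := hdvd
    have hj : j < 0 := by
      by_contra! h
      exact hk.not_ge (by positivity)
    rw [← hg.2 j hj, fourierCoeff, fourierCoeff]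
    have hmeas : AEStronglyMeasurable (fun x => fourier (-j) x • g x) m :=
      (measurable_fourier _).aestronglyMeasurable.smul g.aestronglyMeasurable
    have h := integral_map (μ := m) (f := fun x => fourier (-j) x • g x)
      hmp.measurable.aemeasurable (by rw [hmp.map_eq]; exact hmeas)
    rw [hmp.map_eq] at h
    rw [h]
    congr 1
    ext x
    have he : -((n : ℤ) * j) • x = -j • n • x := by
      rw [← natCast_zsmul, ← mul_zsmul]
      congr 1
      ring
    rw [fourier_apply, fourier_apply, he]
  · have hinv := integral_add_right_eq_self (μ := m)
      (fun x : Torus => fourier (-k) x • g (n • x)) (((1 / n : ℝ)) : Torus)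
    have h1 : ∀ x : Torus, fourier (-k) (x + ((1 / n : ℝ) : Torus)) • g (n • (x + ((1 / n : ℝ) : Torus)))
        = (fourier (-k) ((1 / n : ℝ) : Torus) : ℂ) * (fourier (-k) x • g (n • x)) := by
      intro x
      rw [smul_add, nsmul_inv_coe hn, add_zero, smul_eq_mul, smul_eq_mul, ← mul_assoc]
      congr 1
      rw [fourier_apply, fourier_apply, fourier_apply, smul_add, AddCircle.toCircle_add,
        Circle.coe_mul, mul_comm]
    simp_rw [h1] at hinv
    rw [integral_const_mul] at hinv
    have hne : (fourier (-k) ((1 / n : ℝ) : Torus) : ℂ) ≠ 1 := by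
      rw [Ne, fourier_inv_eq_one_iff hn, dvd_neg]
      exact hdvd
    by_contra h0
    exact hne (mul_right_cancel₀ h0 (hinv.trans (one_mul _).symm))

/-! ### Polynomials in `M_α(z^n)` -/

theorem coeFn_polyFn (p : ℂ[X]) : ∀ᵐ x ∂m, polyFn p x = p.eval (fourier 1 x : ℂ) :=
  ContinuousMap.coeFn_toAEEqFun m _

theorem polyFn_mem_Linf (p : ℂ[X]) : polyFn p ∈ Lp ℂ ∞ m := by
  let F : C(Torus, ℂ) := ⟨fun x => p.eval (fourier 1 x), p.continuous.comp (fourier 1).continuous⟩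
  have h : (ContinuousMap.toLp ∞ m ℂ F : L0) = polyFn p := ContinuousMap.coe_toLp m F
  rw [← h]
  exact (ContinuousMap.toLp ∞ m ℂ F).2

theorem coeFn_rotate (a : Torus) (F : Linf) : ∀ᵐ x ∂m, rotate a F x = F (x - a) :=
  Lp.coeFn_compMeasurePreserving F (measurePreserving_sub_right m a)

theorem rotate_eq_self_of_mem_HinfPow {n : ℕ} (hn : 1 ≤ n) {G : Linf}
    (hG : (G : L0) ∈ HinfPow n) : rotate ((1 / n : ℝ) : Torus) G = G := by
  obtain ⟨g, -, hg⟩ := hG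
  apply Lp.ext
  filter_upwards [coeFn_rotate ((1 / n : ℝ) : Torus) G, hg,
    (measurePreserving_sub_right m ((1 / n : ℝ) : Torus)).quasiMeasurePreserving.ae hg]
    with x h1 h2 h3
  rw [h1, h2, h3, smul_sub, nsmul_inv_coe hn, sub_zero]

/-- For `G ∈ H^∞(z^n)` near `F`, the difference of `F` and its rotate equals that of `F - G` and its
rotate, so its norm is at most `2 α(F - G)`. -/
theorem rotate_eq_self_of_mem_Malpha {α : Seminorm ℂ Linf} (hα : IsRotSymmNorm α) {n : ℕ}
    (hn : 1 ≤ n) {F : Linf} (hF : (F : L0) ∈ Malpha α n) :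
    rotate ((1 / n : ℝ) : Torus) F = F := by
  set a : Torus := ((1 / n : ℝ) : Torus)
  have hsub : ∀ u v : Linf, rotate a (u - v) = rotate a u - rotate a v := fun u v => map_sub _ u v
  rw [eq_comm, ← sub_eq_zero]
  apply hα.eq_zero_of_map_eq_zero
  refine le_antisymm (le_of_forall_pos_le_add fun ε hε => ?_) (apply_nonneg α _)
  obtain ⟨g, hg, hlt⟩ := hF.2 (ENNReal.ofReal (ε / 2)) (ENNReal.ofReal_pos.2 (half_pos hε))
  let G : Linf := ⟨g, (HinfPow_subset_Hinf hn hg).1⟩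
  have hG : rotate a G = G := rotate_eq_self_of_mem_HinfPow hn hg
  have hlt' : α (F - G) < ε / 2 := by
    have h := extNorm_coe hα (F - G)
    rw [← ENNReal.ofReal_lt_ofReal_iff (half_pos hε), ← h]
    exact hlt
  calc α (F - rotate a F) = α ((F - G) - rotate a (F - G)) := by
        rw [hsub, hG, sub_sub_sub_cancel_right]
    _ ≤ α (F - G) + α (rotate a (F - G)) := map_sub_le_add α _ _
    _ ≤ 0 + ε := by
        rw [hα.map_rotate]
        linarith

theorem eq_C_of_polyFn_mem_Malpha {α : Seminorm ℂ Linf} (hα : IsRotSymmNorm α) {n : ℕ}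
    (hn : 1 ≤ n) {p : ℂ[X]} (hdeg : p.natDegree < n) (hp : polyFn p ∈ Malpha α n) :
    p = C (p.coeff 0) := by
  set a : Torus := ((1 / n : ℝ) : Torus)
  let F : Linf := ⟨polyFn p, polyFn_mem_Linf p⟩
  have hrot : rotate a F = F := rotate_eq_self_of_mem_Malpha hα hn hp
  have hae : (fun x : Torus => p.eval (fourier 1 (x - a) : ℂ)) =ᵐ[m]
      fun x : Torus => p.eval (fourier 1 x : ℂ) := by
    have h := coeFn_rotate a F
    rw [hrot] at h
    filter_upwards [h, coeFn_polyFn p,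
      (measurePreserving_sub_right m a).quasiMeasurePreserving.ae (coeFn_polyFn p)] with x h1 h2 h3
    rw [← h2, ← h3]
    exact h1.symm
  have hcont : Continuous fun x : Torus => p.eval (fourier 1 x : ℂ) :=
    p.continuous.comp (fourier 1).continuous
  have hall := congrFun
    (Measure.eq_of_ae_eq hae (hcont.comp (continuous_id.sub continuous_const)) hcont)
  -- Continuity has made the identity hold everywhere on the circle, an infinite set, so it is an
  -- identity of polynomials; its coefficients can be compared.
  have hpoly : p.comp (C (fourier 1 (-a) : ℂ) * X) = p := by
    apply Polynomial.eq_of_infinite_eval_eq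
    have hinj : Function.Injective fun x : Torus => (fourier 1 x : ℂ) := by
      intro x y hxy
      simp only [fourier_one] at hxy
      exact AddCircle.injective_toCircle one_ne_zero (Subtype.ext hxy)
    have : Infinite Torus := by
      have := Set.Ico.infinite (show (0 : ℝ) < 0 + 1 by norm_num)
      exact Infinite.of_injective _ (AddCircle.equivIco (1 : ℝ) 0).symm.injective
    refine (Set.infinite_range_of_injective hinj).mono ?_
    rintro _ ⟨x, rfl⟩
    change eval _ _ = eval _ _
    rw [eval_comp, eval_mul, eval_C, eval_X, ← hall x]
    have hx : (fourier 1 (-a) : ℂ) * fourier 1 x = fourier 1 (x - a) := by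
      rw [fourier_one, fourier_one, fourier_one, sub_eq_add_neg, AddCircle.toCircle_add,
        Circle.coe_mul, mul_comm]
    exact congrArg (fun z => eval z p) hx
  ext k
  rw [coeff_C]
  split_ifs with hk
  · rw [hk]
  by_cases hkn : p.natDegree < k
  · exact coeff_eq_zero_of_natDegree_lt hkn
  have hc := congrArg (fun q => coeff q k) hpoly
  simp only [comp_C_mul_X_coeff] at hc
  by_contra h0
  have h1 : (fourier 1 (-a) : ℂ) ^ k = 1 := mul_left_cancel₀ h0 (hc.trans (mul_one _).symm)
  have h2 : (fourier (-k : ℤ) a : ℂ) = 1 := by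
    rw [← h1, fourier_one, fourier_apply, ← Circle.coe_pow, ← AddCircle.toCircle_nsmul]
    simp
  rw [fourier_inv_eq_one_iff hn, dvd_neg, Int.natCast_dvd_natCast] at h2
  -- A nonzero coefficient at `k ≠ 0` would need `n ∣ k`, yet `k ≤ p.natDegree < n`.
  have := Nat.le_of_dvd (Nat.pos_of_ne_zero hk) h2
  lia

theorem polyFn_C_mul (c : ℂ) (f : L0) : polyFn (C c) * f = f * AEEqFun.const Torus c := by
  apply AEEqFun.ext
  filter_upwards [AEEqFun.coeFn_mul (polyFn (C c)) f, coeFn_polyFn (C c),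
    AEEqFun.coeFn_mul f (AEEqFun.const Torus c), AEEqFun.coeFn_const (μ := m) Torus c]
    with x h1 h2 h3 h4
  rw [h1, h3, Pi.mul_apply, Pi.mul_apply, h2, h4, eval_C, mul_comm]
  rfl

end GaugeHardy

open GaugeHardy

theorem mainTheorem10 (α : Seminorm ℂ GaugeHardy.Linf) (hα : GaugeHardy.IsRotSymmNorm α)
    (hcont : GaugeHardy.IsContinuousNorm α) (n : ℕ) (hn : 1 ≤ n) (f : GaugeHardy.L0)
    (hf : GaugeHardy.IsNOuter α n f) (hfM : f ∈ GaugeHardy.Malpha α n) :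
    GaugeHardy.IsOuter α f := by
  obtain ⟨hfH, p, hp0, hdeg, hp⟩ := hf
  have hone : (AEEqFun.const Torus (1 : ℂ) : L0) ∈ Malpha α n :=
    mem_alphaClosure_of_mem hα (const_mem_HinfPow hn 1)
      (Linf_subset_scriptL hα (Lp.const ∞ m (1 : ℂ)))
  have hsub : alphaClosure α (mulSet f (HinfPow n)) ⊆ Malpha α n := by
    apply alphaClosure_subset_alphaClosure hα
    rintro _ ⟨h, hh, rfl⟩
    exact mul_mem_alphaClosure (HinfPow_subset_Hinf hn hh).1
      (fun g hg => mul_mem_HinfPow hn hg hh) hfM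
  have hpmem : polyFn p ∈ alphaClosure α (mulSet f (HinfPow n)) := by
    rw [hp]
    exact ⟨_, hone, mul_one _⟩
  have hpC := eq_C_of_polyFn_mem_Malpha hα hn hdeg (hsub hpmem)
  set c := p.coeff 0
  have hc : c ≠ 0 := by
    rintro h
    rw [h, C_0] at hpC
    exact hp0 hpC
  have hcmem : polyFn (C c) ∈ alphaClosure α (mulSet f Hinf) := by
    rw [← hpC]
    exact alphaClosure_mono α (Set.image_mono (HinfPow_subset_Hinf hn)) hpmem
  refine ⟨hfH, (alphaClosure_subset_alphaClosure hα ?_).antisymm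
    (alphaClosure_subset_alphaClosure hα ?_)⟩
  · rintro _ ⟨h, hh, rfl⟩
    exact mul_mem_alphaClosure hh.1 (fun g hg => mul_mem_Hinf hg hh) hfH
  · intro h hh
    -- `h` is the constant `c ∈ [f · H^∞]_α` times `c⁻¹ h ∈ H^∞`, and the closure is stable under
    -- such products.
    have hh' : h * AEEqFun.const Torus c⁻¹ ∈ Hinf := mul_mem_Hinf hh (const_mem_Hinf _)
    have hcc : polyFn (C c) * (h * AEEqFun.const Torus c⁻¹) = h := by
      have h1 : (AEEqFun.const Torus c⁻¹ * AEEqFun.const Torus c : L0) = 1 := by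
        change (AEEqFun.const Torus (c⁻¹ * c) : L0) = AEEqFun.const Torus 1
        rw [inv_mul_cancel₀ hc]
      rw [polyFn_C_mul, mul_assoc, h1, mul_one]
    rw [← hcc]
    refine mul_mem_alphaClosure hh'.1 ?_ hcmem
    rintro _ ⟨g, hg, rfl⟩
    exact ⟨g * (h * AEEqFun.const Torus c⁻¹), mul_mem_Hinf hg hh', (mul_assoc _ _ _).symm⟩
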